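/- Fix $N,T\ge 1$, let $\mathcal X=\mathcal Y=\{x\in\mathbb R^N:\|x\|_2\le 1\}$ and $\Phi(\Theta)=\max_{w\in\mathcal X}\langle w,\Theta\rangle$; then $\Phi(\Theta)=\|\Theta\|_2$. For $\eta>0$ let $\tilde\Phi_\eta(\Theta)=\mathbb E_{u\sim\mathcal N(0,I)}[\Phi(\Theta+\eta u)]$. This expectation exists, $\tilde\Phi_\eta$ is differentiable on $\mathbb R^N$, and $\nabla\tilde\Phi_\eta(\Theta)\in\mathcal X$ for all $\Theta$. Given rewards $\theta_1,\dots,\theta_T\in\mathcal Y$, put $\Theta_t=\sum_{s=1}^t\theta_s$ (with $\Theta_0=0$). The gradient-based prediction algorithm (GBPA) with Gaussian smoothing and scaling parameters $\eta_1,\dots,\eta_T$ plays $w_t=\nabla\tilde\Phi_{\eta_t}(\Theta_{t-1})$ in round $t$, and its regret is $\mathrm{Regret}=\max_{w\in\mathcal X}\langle w,\Theta_T\rangle-\sum_{t=1}^T\langle w_t,\theta_t\rangle$. (1) If $0<\eta_1\le\eta_2\le\dots\le\eta_T$, then $$\mathrm{Regret}\le\eta_T\sqrt N+\frac1{2\sqrt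 N}\sum_{t=1}^T\frac1{\eta_t}\|\theta_t\|_2^2 .$$ (2) If $\eta_t=\sqrt{\sum_{s=1}^T\|\theta_s\|_2^2/(2N)}$ for all $t$ (tuned in hindsight), then $\mathrm{Regret}\le\sqrt{2\sum_{t=1}^T\|\theta_t\|_2^2}$. (If all $\theta_t$ are $0$, then $\eta_t=0$ and the regret is $0$ whatever is played.) (3) If $\eta_t=\sqrt{(1+\sum_{s=1}^{t-1}\|\theta_s\|_2^2)/N}$ for all $t$ (adaptive), then $\mathrm{Regret}\le 2\sqrt{1+\sum_{t=1}^T\|\theta_t\|_2^2}$. (4) The adaptive algorithm in (3) is minimax optimal up to a constant. A strategy of the learner chooses $w_t\in\mathcal X$ as a function of $\theta_1,\dots,\theta_{t-1}$; the adaptive algorithm is one. Let $V_{N,T}=\inf_A\sup_{\theta_1,\dots,\theta_T\in\mathcal Y}\mathrm{Regret}(A;\theta_1,\dots,\theta_T)$, the infimum being over all strategies $A$. There is a universal constant $C>0$ such that for all $N,T\ge1$ the worst-case regret of the adaptive algorithm is at most $2\sqrt{1+T}$, and $2\sqrt{1+T}\le C\,V_{N,T}$. -/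

import Mathlib

open MeasureTheory ProbabilityTheory

noncomputable section

namespace OLO

section General

variable {E : Type*} [NormedAddCommGroup E] [InnerProductSpace ℝ E]

/-- The cumulative reward vector `θ₁ + ⋯ + θ_t` (rounds are numbered from `1`). -/
def cumReward (θ : ℕ → E) (t : ℕ) : E := ∑ s ∈ Finset.Icc 1 t, θ s

/-- The baseline potential of the decision set `X`, i.e. its support function
`Θ ↦ max_{w ∈ X} ⟨w, Θ⟩`. -/
def baselinePotential (X : Set E) (Θ : E) : ℝ := sSup ((fun w => inner ℝ w Θ) '' X)

/-- The regret after `T` rounds with decision set `X`, when the learner plays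
`w₁, …, w_T` and the reward vectors are `θ₁, …, θ_T`. -/
def regret (X : Set E) (T : ℕ) (w θ : ℕ → E) : ℝ :=
  baselinePotential X (cumReward θ T) - ∑ t ∈ Finset.Icc 1 T, inner ℝ (w t) (θ t)

/-- The plays of the gradient-based prediction algorithm with the potentials `Φ₁, Φ₂, …`
against the rewards `θ`: in round `t` it plays the gradient of `Φ_t` at the
cumulative reward of the rounds before `t`. -/
def gbpaPlay [CompleteSpace E] (Φ : ℕ → E → ℝ) (θ : ℕ → E) (t : ℕ) : E :=
  gradient (Φ t) (cumReward θ (t - 1))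

/-- The stochastic smoothing `Θ ↦ 𝔼_{u ∼ D} Φ(Θ + η u)` of `Φ` with scaling parameter `η`. -/
def smoothing [MeasurableSpace E] (D : Measure E) (Φ : E → ℝ) (η : ℝ) (Θ : E) : ℝ :=
  ∫ u, Φ (Θ + η • u) ∂D

/-- All rewards of the rounds `1, …, T` lie in the reward set `Y`. -/
def IsRewardSeq (Y : Set E) (T : ℕ) (θ : ℕ → E) : Prop :=
  ∀ t ∈ Finset.Icc 1 T, θ t ∈ Y

/-- `A` is a strategy of the learner in the `T`-round game with decision set `X` and reward
set `Y`: against the reward sequence `θ` it plays `A θ t` in round `t`, this is a point of `X`,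
and it depends only on the rewards revealed before round `t`. -/
def IsLearner (X Y : Set E) (T : ℕ) (A : (ℕ → E) → ℕ → E) : Prop :=
  (∀ θ, IsRewardSeq Y T θ → ∀ t ∈ Finset.Icc 1 T, A θ t ∈ X) ∧
  (∀ θ θ', IsRewardSeq Y T θ → IsRewardSeq Y T θ' → ∀ t ∈ Finset.Icc 1 T,
    (∀ s ∈ Finset.Icc 1 (t - 1), θ s = θ' s) → A θ t = A θ' t)

/-- The supremum over all reward sequences of the regret of the strategy `A`. -/
def worstCaseRegret (X Y : Set E) (T : ℕ) (A : (ℕ → E) → ℕ → E) : EReal :=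
  ⨆ (θ : ℕ → E) (_ : IsRewardSeq Y T θ), ((regret X T (A θ) θ : ℝ) : EReal)

/-- The minimax regret of the `T`-round game: the infimum over all strategies of the learner of
the worst-case regret. -/
def minimaxRegret (X Y : Set E) (T : ℕ) : EReal :=
  ⨅ (A : (ℕ → E) → ℕ → E) (_ : IsLearner X Y T A), worstCaseRegret X Y T A

end General

/-- The Euclidean unit ball of `ℝ^N`, which is both the decision set and the reward set. -/
def ball (N : ℕ) : Set (EuclideanSpace ℝ (Fin N)) := Metric.closedBall 0 1

/-- The smoothing of the baseline potential of the Euclidean ball by the standard Gaussian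
distribution `𝒩(0, I)`, with scaling parameter `η`. -/
def gaussPotential (N : ℕ) (η : ℝ) : EuclideanSpace ℝ (Fin N) → ℝ :=
  smoothing (stdGaussian (EuclideanSpace ℝ (Fin N))) (baselinePotential (ball N)) η

/-- The plays of the gradient-based prediction algorithm with Gaussian smoothing and scaling
parameters `η₁, η₂, …`, against the rewards `θ`. -/
def gaussGBPA (N : ℕ) (η : ℕ → ℝ) (θ : ℕ → EuclideanSpace ℝ (Fin N)) :
    ℕ → EuclideanSpace ℝ (Fin N) :=
  gbpaPlay (fun t => gaussPotential N (η t)) θ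

/-- The constant scaling parameter tuned in hindsight. -/
def hindsightScale (N T : ℕ) (θ : ℕ → EuclideanSpace ℝ (Fin N)) (_t : ℕ) : ℝ :=
  Real.sqrt ((∑ s ∈ Finset.Icc 1 T, ‖θ s‖ ^ 2) / (2 * (N : ℝ)))

/-- The adaptive scaling parameter, which depends only on the rewards before round `t`. -/
def adaptiveScale (N : ℕ) (θ : ℕ → EuclideanSpace ℝ (Fin N)) (t : ℕ) : ℝ :=
  Real.sqrt ((1 + ∑ s ∈ Finset.Icc 1 (t - 1), ‖θ s‖ ^ 2) / (N : ℝ))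

end OLO

end

/-!
The regret analysis rests on one property of the smoothed norm `F_η Θ = 𝔼 ‖Θ + η u‖`: its curvature
is at most `1 / (η √N)`. Given this, each round increases the potential by at most the learner's
gain plus `‖θ t‖² / (2 η √N)`, raising the scale costs at most `(η' - η) √N` since
`𝔼 ‖u‖ ≤ √N`, and `F_η` is at least the norm by Jensen; summing over the rounds
(`OLO.regret_gaussGBPA_le`) gives the general bound, and the tuned bounds follow by arithmetic.

The curvature bound (`OLO.convexOn_norm_sq_sub_gaussPotential`) is stated as convexity of
`‖Θ‖² / (2 η √N) - F_η Θ`, so that no second derivative is needed. By scaling, let `η = 1`.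
With `J = ∫₀^∞ (1 - e^{-t}) t^{-3/2} dt`, the norm is the mixture
`J ‖x‖ = ∫₀^∞ (1 - e^{-t ‖x‖²}) t^{-3/2} dt`. Taking expectations, `J F_1 Θ` is the same mixture of
`1 - A e^{-b ‖Θ‖²}`, where `A = (1 + 2t)^{-N/2}` and `b = t / (1 + 2t)`. Each of these functions has
its largest curvature, `2 A b`, at the origin; so does `F_1`, and an integration by parts in `t`
(`OLO.integral_curvature`) shows that the curvature there is `𝔼 ‖u‖ / N ≤ 1 / √N`.

For the minimax lower bound (`OLO.le_minimaxRegret`), an adversary plays `± e` for a unit vector `e`.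
It is a derandomized form of random signs: these make the learner's expected gain zero while
`𝔼 |ε₁ + ⋯ + ε_T| ≥ √(T/3)`, by a lower bound of `|s|` by a quartic polynomial.
The adversary chooses the signs so as to keep a corresponding potential from decreasing
(`OLO.exists_adversary`).
-/

namespace OLO

/-! ### The baseline potential and elementary properties of its smoothing -/

lemma baselinePotential_ball_isGreatest {N : ℕ} (Θ : EuclideanSpace ℝ (Fin N)) :
    IsGreatest ((fun w => inner ℝ w Θ) '' ball N) ‖Θ‖ := by
  constructor
  · refine ⟨‖Θ‖⁻¹ • Θ, ?_, ?_⟩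
    · rw [ball, mem_closedBall_zero_iff, norm_smul, norm_inv, norm_norm]
      exact inv_mul_le_one
    · rcases eq_or_ne Θ 0 with rfl | h
      · simp
      · have : ‖Θ‖ ≠ 0 := norm_ne_zero_iff.2 h
        simp only [real_inner_smul_left, real_inner_self_eq_norm_sq]
        field_simp
  · rintro _ ⟨w, hw, rfl⟩
    rw [ball, mem_closedBall_zero_iff] at hw
    exact (real_inner_le_norm w Θ).trans (mul_le_of_le_one_left (norm_nonneg _) hw)

lemma baselinePotential_ball {N : ℕ} :
    baselinePotential (ball N) = fun Θ => ‖Θ‖ :=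
  funext fun Θ => (baselinePotential_ball_isGreatest Θ).csSup_eq

lemma gaussPotential_apply {N : ℕ} (η : ℝ) (x : EuclideanSpace ℝ (Fin N)) :
    gaussPotential N η x = ∫ u, ‖x + η • u‖ ∂stdGaussian (EuclideanSpace ℝ (Fin N)) := by
  rw [gaussPotential, smoothing, baselinePotential_ball]

lemma integrable_id_stdGaussian {N : ℕ} :
    Integrable (fun u => u) (stdGaussian (EuclideanSpace ℝ (Fin N))) :=
  IsGaussian.integrable_id

lemma integrable_norm_add_smul {N : ℕ} (η : ℝ) (x : EuclideanSpace ℝ (Fin N)) :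
    Integrable (fun u => ‖x + η • u‖) (stdGaussian (EuclideanSpace ℝ (Fin N))) :=
  ((integrable_const x).add (integrable_id_stdGaussian.smul η)).norm

lemma nullSingletonClass_stdGaussian {N : ℕ} (hN : 1 ≤ N) :
    NullSingletonClass (stdGaussian (EuclideanSpace ℝ (Fin N))) := by
  have h1 : NullSingletonClass (gaussianReal 0 1) := nullSingletonClass_gaussianReal one_ne_zero
  have h2 : NullSingletonClass (Measure.pi fun _ : Fin N => gaussianReal 0 1) :=
    Measure.pi_nullSingletonClass (μ := fun _ : Fin N => gaussianReal 0 1) ⟨0, hN⟩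
  refine ⟨fun a => ?_⟩
  rw [← map_pi_eq_stdGaussian, Measure.map_apply (by fun_prop) (measurableSet_singleton a)]
  exact (Set.subsingleton_singleton.preimage
    (WithLp.toLp_injective 2)).measure_zero _

lemma gaussPotential_norm_sub_le {N : ℕ} (η : ℝ) (x y : EuclideanSpace ℝ (Fin N)) :
    ‖gaussPotential N η x - gaussPotential N η y‖ ≤ ‖x - y‖ := by
  rw [gaussPotential_apply, gaussPotential_apply,
    ← integral_sub (integrable_norm_add_smul η x) (integrable_norm_add_smul η y)]
  refine (norm_integral_le_of_norm_le_const (C := ‖x - y‖) (Filter.Eventually.of_forall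
    fun u => ?_)).trans (by simp)
  simpa using abs_norm_sub_norm_le (x + η • u) (y + η • u)

/-- The norm is differentiable off the origin, which the perturbed point `x + η • u` almost surely
avoids, and it is Lipschitz, so differentiation passes under the expectation. -/
lemma differentiable_gaussPotential {N : ℕ} (hN : 1 ≤ N) {η : ℝ} (hη : 0 < η) :
    Differentiable ℝ (gaussPotential N η) := by
  intro x
  have := nullSingletonClass_stdGaussian hN
  have hF : gaussPotential N η = fun x => ∫ u, ‖x + η • u‖ ∂stdGaussian _ :=
    funext (gaussPotential_apply η)
  rw [hF]
  refine (hasFDerivAt_integral_of_dominated_loc_of_lip (𝕜 := ℝ) (bound := fun _ => 1)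
    (F' := fun u => fderiv ℝ (fun y => ‖y + η • u‖) x) (Metric.ball_mem_nhds x one_pos)
    (Filter.Eventually.of_forall fun y => (integrable_norm_add_smul η y).aestronglyMeasurable)
    (integrable_norm_add_smul η x) ?_ ?_ (integrable_const _) ?_).2.differentiableAt
  · exact ((measurable_fderiv_with_param ℝ
      (f := fun u y : EuclideanSpace ℝ (Fin N) => ‖y + η • u‖) (by fun_prop)).comp
      (measurable_id.prodMk measurable_const)).aestronglyMeasurable
  · refine Filter.Eventually.of_forall fun u => LipschitzOnWith.of_dist_le_mul fun y _ z _ => ?_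
    simpa [dist_eq_norm] using abs_norm_sub_norm_le (y + η • u) (z + η • u)
  · have h0 : ∀ᵐ u ∂stdGaussian (EuclideanSpace ℝ (Fin N)), u ≠ -(η⁻¹ • x) := by
      simp [ae_iff]
    filter_upwards [h0] with u hu
    have hne : x + η • u ≠ 0 := by
      intro h
      apply hu
      rw [← inv_smul_smul₀ hη.ne' u, eq_neg_of_add_eq_zero_right h, smul_neg]
    exact (((differentiableAt_id.add_const (η • u)).norm ℝ hne)).hasFDerivAt

lemma norm_gradient_gaussPotential_le {N : ℕ} (η : ℝ) (x : EuclideanSpace ℝ (Fin N)) :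
    ‖gradient (gaussPotential N η) x‖ ≤ 1 := by
  rw [gradient, LinearIsometryEquiv.norm_map]
  exact norm_fderiv_le_of_lipschitz ℝ (C := 1) (LipschitzWith.of_dist_le_mul fun y z => by
    simpa [dist_eq_norm] using gaussPotential_norm_sub_le η y z)

/-- Jensen's inequality for the norm: the perturbation `η • u` is centred. -/
lemma norm_le_gaussPotential {N : ℕ} (η : ℝ) (x : EuclideanSpace ℝ (Fin N)) :
    ‖x‖ ≤ gaussPotential N η x := by
  have h : ∫ u, (x + η • u) ∂stdGaussian (EuclideanSpace ℝ (Fin N)) = x := by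
    rw [integral_add (integrable_const x) (g := fun u => η • u)
      (integrable_id_stdGaussian.smul η), integral_smul,
      integral_id_stdGaussian]
    simp
  rw [gaussPotential_apply]
  calc ‖x‖ = ‖∫ u, (x + η • u) ∂stdGaussian (EuclideanSpace ℝ (Fin N))‖ := by rw [h]
    _ ≤ _ := norm_integral_le_integral_norm _

/-! ### Gaussian integrals -/

lemma integral_norm_sq_stdGaussian (N : ℕ) :
    ∫ u, ‖u‖ ^ 2 ∂stdGaussian (EuclideanSpace ℝ (Fin N)) = N := by
  have hg : Integrable (fun x : ℝ => x ^ 2) (gaussianReal 0 1) :=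
    (IsGaussian.memLp_two_id (μ := gaussianReal 0 1)).integrable_sq
  have h1 : ∫ x, x ^ 2 ∂gaussianReal 0 1 = 1 := by
    have := variance_id_gaussianReal (μ := 0) (v := 1)
    rw [variance_eq_sub IsGaussian.memLp_two_id] at this
    simpa using this
  have hi (i : Fin N) : Integrable (fun x : Fin N → ℝ => x i ^ 2)
      (Measure.pi fun _ => gaussianReal 0 1) :=
    integrable_comp_eval (μ := fun _ : Fin N => gaussianReal 0 1) (f := fun x : ℝ => x ^ 2) hg
  rw [← map_pi_eq_stdGaussian, integral_map (by fun_prop) (by fun_prop)]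
  simp only [EuclideanSpace.real_norm_sq_eq]
  rw [integral_finsetSum _ fun i _ => hi i]
  simp_rw [integral_comp_eval (μ := fun _ : Fin N => gaussianReal 0 1)
    (f := fun x : ℝ => x ^ 2) hg.aestronglyMeasurable, h1]
  simp

lemma integral_norm_stdGaussian_le (N : ℕ) :
    ∫ u, ‖u‖ ∂stdGaussian (EuclideanSpace ℝ (Fin N)) ≤ √N := by
  have h := integral_norm_sq_stdGaussian N
  have hv := variance_nonneg (fun u => ‖u‖) (stdGaussian (EuclideanSpace ℝ (Fin N)))
  rw [variance_eq_sub (X := fun u => ‖u‖)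
    (IsGaussian.memLp_two_id (μ := stdGaussian (EuclideanSpace ℝ (Fin N)))).norm] at hv
  refine Real.le_sqrt_of_sq_le ?_
  simpa [h] using hv

/-- One coordinate of `integral_exp_neg_mul_norm_add_sq`, by completing the square. -/
lemma integral_exp_neg_mul_add_sq_gaussianReal {t : ℝ} (ht : 0 ≤ t) (a : ℝ) :
    ∫ u, Real.exp (-t * (a + u) ^ 2) ∂gaussianReal 0 1 =
      (1 + 2 * t) ^ (-(1 / 2) : ℝ) * Real.exp (-(t / (1 + 2 * t)) * a ^ 2) := by
  rw [integral_gaussianReal_eq_integral_smul one_ne_zero]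
  have h (u : ℝ) : gaussianPDFReal 0 1 u • Real.exp (-t * (a + u) ^ 2) =
      ((√(2 * Real.pi))⁻¹ * Real.exp (-(t / (1 + 2 * t)) * a ^ 2)) *
        Real.exp (-(t + 1 / 2) * (u + 2 * t * a / (1 + 2 * t)) ^ 2) := by
    simp only [gaussianPDFReal, smul_eq_mul, NNReal.coe_one, mul_one, sub_zero]
    rw [mul_assoc, mul_assoc, ← Real.exp_add, ← Real.exp_add]
    congr 2
    field_simp
    ring
  simp_rw [h]
  rw [integral_const_mul, integral_add_right_eq_self
    (fun u => Real.exp (-(t + 1 / 2) * u ^ 2)), integral_gaussian, mul_right_comm]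
  congr 1
  rw [Real.rpow_neg (by positivity), ← Real.sqrt_eq_rpow, ← Real.sqrt_inv, ← Real.sqrt_inv,
    ← Real.sqrt_mul (by positivity)]
  congr 1
  have := Real.pi_pos
  field_simp
  ring

/-- The Laplace transform of the noncentral chi-squared distribution. -/
lemma integral_exp_neg_mul_norm_add_sq {N : ℕ} {t : ℝ} (ht : 0 ≤ t)
    (x : EuclideanSpace ℝ (Fin N)) :
    ∫ u, Real.exp (-t * ‖x + u‖ ^ 2) ∂stdGaussian (EuclideanSpace ℝ (Fin N)) =
      (1 + 2 * t) ^ (-(N / 2) : ℝ) * Real.exp (-(t / (1 + 2 * t)) * ‖x‖ ^ 2) := by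
  rw [← map_pi_eq_stdGaussian, integral_map (by fun_prop) (by fun_prop)]
  simp only [EuclideanSpace.real_norm_sq_eq, Finset.mul_sum, Real.exp_sum, PiLp.add_apply]
  rw [integral_fintype_prod_eq_prod (fun i u => Real.exp (-t * (x i + u) ^ 2))]
  simp_rw [integral_exp_neg_mul_add_sq_gaussianReal ht]
  rw [Finset.prod_mul_distrib, Finset.prod_const, ← Real.rpow_natCast,
    ← Real.rpow_mul (by positivity)]
  simp
  left; congr 1; ring

/-! ### The norm as a mixture of Gaussians -/

/-- The constant `J = ∫₀^∞ (1 - e^{-t}) t^{-3/2} dt` for which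
`J * r = ∫₀^∞ (1 - e^{-t r²}) t^{-3/2} dt`. Only its positivity matters, not its value. -/
noncomputable def levyConst : ℝ := ∫ t in Set.Ioi (0 : ℝ), (1 - Real.exp (-t)) * t ^ (-(3 / 2) : ℝ)

/-- Up to a constant, this function dominates all the integrands in the mixing variable `t`. -/
lemma integrableOn_min_rpow :
    IntegrableOn (fun t : ℝ => min t 1 * t ^ (-(3 / 2) : ℝ)) (Set.Ioi 0) := by
  rw [← Set.Ioc_union_Ioi_eq_Ioi zero_le_one, integrableOn_union]
  constructor
  · have h : IntegrableOn (fun t : ℝ => t ^ (-(1 / 2) : ℝ)) (Set.Ioc 0 1) :=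
      (intervalIntegrable_iff_integrableOn_Ioc_of_le zero_le_one).1
        (intervalIntegral.intervalIntegrable_rpow' (by norm_num))
    refine h.congr_fun (fun t ht => ?_) measurableSet_Ioc
    simp only [min_eq_left ht.2]
    rw [← Real.rpow_one_add' ht.1.le (by norm_num)]
    norm_num
  · refine (integrableOn_Ioi_rpow_of_lt (by norm_num : (-(3 / 2) : ℝ) < -1) one_pos).congr_fun
      (fun t ht => ?_) measurableSet_Ioi
    simp [min_eq_right (le_of_lt (Set.mem_Ioi.1 ht))]

lemma integrableOn_of_abs_le_mul_min {f : ℝ → ℝ} (hf : Measurable f) (C : ℝ)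
    (h : ∀ t, 0 < t → |f t| ≤ C * min t 1) :
    IntegrableOn (fun t => f t * t ^ (-(3 / 2) : ℝ)) (Set.Ioi 0) := by
  refine (integrableOn_min_rpow.const_mul C).mono' (by fun_prop) ?_
  refine (ae_restrict_mem measurableSet_Ioi).mono fun t ht => ?_
  have ht : 0 < t := ht
  rw [norm_mul, Real.norm_eq_abs, Real.norm_of_nonneg (by positivity), ← mul_assoc]
  exact mul_le_mul_of_nonneg_right (h t ht) (by positivity)

lemma one_sub_exp_neg_mem {a : ℝ} (ha : 0 ≤ a) :
    0 ≤ 1 - Real.exp (-a) ∧ 1 - Real.exp (-a) ≤ min a 1 := by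
  refine ⟨?_, le_min ?_ ?_⟩
  · simpa using ha
  · linarith [Real.add_one_le_exp (-a)]
  · linarith [Real.exp_pos (-a)]

lemma abs_one_sub_exp_neg_mul_le {s t : ℝ} (hs : 0 ≤ s) (ht : 0 < t) :
    |1 - Real.exp (-t * s)| ≤ max s 1 * min t 1 := by
  obtain ⟨h0, h1⟩ := one_sub_exp_neg_mem (mul_nonneg ht.le hs)
  rw [neg_mul, abs_of_nonneg h0]
  rcases le_total t 1 with h | h
  · rw [min_eq_left h, mul_comm (max s 1)]
    exact (h1.trans (min_le_left _ _)).trans (mul_le_mul_of_nonneg_left (le_max_left _ _) ht.le)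
  · rw [min_eq_right h, mul_one]
    exact (h1.trans (min_le_right _ _)).trans (le_max_right _ _)

lemma integrableOn_one_sub_exp_neg_mul {s : ℝ} (hs : 0 ≤ s) :
    IntegrableOn (fun t => (1 - Real.exp (-t * s)) * t ^ (-(3 / 2) : ℝ)) (Set.Ioi 0) :=
  integrableOn_of_abs_le_mul_min (by fun_prop) (max s 1)
    fun _ ht => abs_one_sub_exp_neg_mul_le hs ht

lemma levyConst_pos : 0 < levyConst := by
  have hi := integrableOn_one_sub_exp_neg_mul zero_le_one
  simp only [mul_one] at hi
  rw [levyConst, setIntegral_pos_iff_support_of_nonneg_ae _ hi]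
  · have : Function.support (fun t : ℝ => (1 - Real.exp (-t)) * t ^ (-(3 / 2) : ℝ)) ∩ Set.Ioi 0
        = Set.Ioi 0 := by
      refine Set.inter_eq_right.2 fun t (ht : 0 < t) => ?_
      have : Real.exp (-t) < 1 := by simpa using ht
      exact mul_ne_zero (by linarith) (by positivity)
    rw [this]
    simp
  · refine (ae_restrict_mem measurableSet_Ioi).mono fun t (ht : 0 < t) => ?_
    exact mul_nonneg (one_sub_exp_neg_mem ht.le).1 (by positivity)

/-- The norm as a mixture of the functions `1 - exp (-t * r ^ 2)`, whose Gaussian smoothings are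
explicit. -/
lemma integral_one_sub_exp_neg_mul_sq {r : ℝ} (hr : 0 ≤ r) :
    ∫ t in Set.Ioi (0 : ℝ), (1 - Real.exp (-t * r ^ 2)) * t ^ (-(3 / 2) : ℝ) = levyConst * r := by
  rcases hr.eq_or_lt with rfl | hr
  · simp
  have h := integral_comp_mul_left_Ioi
    (fun t : ℝ => (1 - Real.exp (-t)) * t ^ (-(3 / 2) : ℝ)) 0 (pow_pos hr 2)
  rw [mul_zero, ← levyConst, smul_eq_mul] at h
  have h3 : (r ^ 2) ^ (-(3 / 2) : ℝ) = (r ^ 3)⁻¹ := by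
    rw [← Real.rpow_natCast, ← Real.rpow_mul hr.le, ← Real.rpow_natCast, ← Real.rpow_neg hr.le]
    norm_num
  have h4 : ∫ t in Set.Ioi (0 : ℝ), (1 - Real.exp (-(r ^ 2 * t))) * (r ^ 2 * t) ^ (-(3 / 2) : ℝ)
      = (r ^ 3)⁻¹ * ∫ t in Set.Ioi (0 : ℝ),
        (1 - Real.exp (-t * r ^ 2)) * t ^ (-(3 / 2) : ℝ) := by
    rw [← integral_const_mul]
    refine setIntegral_congr_fun measurableSet_Ioi fun t (ht : 0 < t) => ?_
    simp only [Real.mul_rpow (sq_nonneg r) ht.le, h3]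
    ring_nf
  rw [h4, inv_mul_eq_iff_eq_mul₀ (by positivity)] at h
  rw [h]
  field_simp

variable {N : ℕ}

/-- The smoothed norm as a mixture of smoothed Gaussians: integrate
`integral_one_sub_exp_neg_mul_sq` over `u` and exchange the integrals. -/
lemma levy_gaussPotential (x : EuclideanSpace ℝ (Fin N)) :
    IntegrableOn (fun t : ℝ => (1 - (1 + 2 * t) ^ (-(N / 2) : ℝ) *
      Real.exp (-(t / (1 + 2 * t)) * ‖x‖ ^ 2)) * t ^ (-(3 / 2) : ℝ)) (Set.Ioi 0) ∧
    levyConst * gaussPotential N 1 x = ∫ t in Set.Ioi (0 : ℝ), (1 - (1 + 2 * t) ^ (-(N / 2) : ℝ) *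
      Real.exp (-(t / (1 + 2 * t)) * ‖x‖ ^ 2)) * t ^ (-(3 / 2) : ℝ) := by
  set γ := stdGaussian (EuclideanSpace ℝ (Fin N))
  let f : EuclideanSpace ℝ (Fin N) → ℝ → ℝ := fun u t =>
    (1 - Real.exp (-t * ‖x + u‖ ^ 2)) * t ^ (-(3 / 2) : ℝ)
  have hint (u) : ∫ t in Set.Ioi (0 : ℝ), f u t = levyConst * ‖x + u‖ :=
    integral_one_sub_exp_neg_mul_sq (norm_nonneg _)
  have hnn : ∀ᵐ t ∂volume.restrict (Set.Ioi (0 : ℝ)), ∀ u, 0 ≤ f u t := by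
    refine (ae_restrict_mem measurableSet_Ioi).mono fun t (ht : 0 < t) u => ?_
    refine mul_nonneg ?_ (by positivity)
    rw [neg_mul]
    exact (one_sub_exp_neg_mem (by positivity)).1
  have hprod : Integrable (Function.uncurry f) (γ.prod (volume.restrict (Set.Ioi 0))) := by
    rw [integrable_prod_iff (Measurable.aestronglyMeasurable (by simp only [f]; fun_prop))]
    refine ⟨Filter.Eventually.of_forall fun u =>
      integrableOn_one_sub_exp_neg_mul (sq_nonneg ‖x + u‖), ?_⟩
    have : (fun u => ∫ t in Set.Ioi (0 : ℝ), ‖Function.uncurry f (u, t)‖) =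
        fun u => levyConst * ‖x + u‖ := by
      funext u
      rw [← hint u]
      refine integral_congr_ae (hnn.mono fun t ht => ?_)
      exact Real.norm_of_nonneg (ht u)
    rw [this]
    simpa using (integrable_norm_add_smul 1 x).const_mul levyConst
  have hinner : ∀ t ∈ Set.Ioi (0 : ℝ), ∫ u, f u t ∂γ = (1 - (1 + 2 * t) ^ (-(N / 2) : ℝ) *
      Real.exp (-(t / (1 + 2 * t)) * ‖x‖ ^ 2)) * t ^ (-(3 / 2) : ℝ) := by
    intro t (ht : 0 < t)
    have hi : Integrable (fun u => Real.exp (-t * ‖x + u‖ ^ 2)) γ := by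
      refine Integrable.of_bound (by fun_prop) 1 (Filter.Eventually.of_forall fun u => ?_)
      rw [Real.norm_of_nonneg (Real.exp_nonneg _), Real.exp_le_one_iff, neg_mul]
      exact neg_nonpos.2 (by positivity)
    simp only [f]
    rw [integral_mul_const, integral_sub (integrable_const _) hi,
      integral_exp_neg_mul_norm_add_sq ht.le]
    simp
  constructor
  · exact IntegrableOn.congr_fun hprod.integral_prod_right hinner measurableSet_Ioi
  · rw [← setIntegral_congr_fun measurableSet_Ioi hinner, ← integral_integral_swap hprod]
    simp_rw [hint]
    rw [integral_const_mul, gaussPotential_apply]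
    simp [γ]

/-- The integral is `J / 2` times the second derivative of the smoothed norm at the origin in any
direction. Integration by parts evaluates it in terms of `𝔼 ‖u‖`. -/
lemma integral_curvature (N : ℕ) :
    IntegrableOn (fun t : ℝ => (1 + 2 * t) ^ (-(N / 2) : ℝ) * (t / (1 + 2 * t)) *
      t ^ (-(3 / 2) : ℝ)) (Set.Ioi 0) ∧
    N * ∫ t in Set.Ioi (0 : ℝ), (1 + 2 * t) ^ (-(N / 2) : ℝ) * (t / (1 + 2 * t)) *
      t ^ (-(3 / 2) : ℝ) = levyConst * gaussPotential N 1 0 / 2 := by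
  have hi1 : IntegrableOn (fun t : ℝ => (1 + 2 * t) ^ (-(N / 2) : ℝ) * (t / (1 + 2 * t)) *
      t ^ (-(3 / 2) : ℝ)) (Set.Ioi 0) := by
    refine integrableOn_of_abs_le_mul_min (by fun_prop) 1 fun t ht => ?_
    have hA : (1 + 2 * t) ^ (-(N / 2) : ℝ) ≤ 1 :=
      Real.rpow_le_one_of_one_le_of_nonpos (by linarith) (neg_nonpos.2 (by positivity))
    have hb : t / (1 + 2 * t) ≤ min t 1 :=
      le_min (div_le_self ht.le (by linarith)) ((div_le_one (by positivity)).2 (by linarith))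
    rw [abs_of_nonneg (by positivity)]
    exact mul_le_mul hA hb (by positivity) zero_le_one
  refine ⟨hi1, ?_⟩
  obtain ⟨hi2, h2⟩ := levy_gaussPotential (0 : EuclideanSpace ℝ (Fin N))
  rw [h2]
  simp only [norm_zero, ne_eq, OfNat.ofNat_ne_zero, not_false_eq_true, zero_pow, mul_zero,
    Real.exp_zero, mul_one] at hi2 ⊢
  -- An antiderivative of the difference of the two integrands, vanishing at `0` and at `∞`.
  let G : ℝ → ℝ := fun t => (1 - (1 + 2 * t) ^ (-(N / 2) : ℝ)) * t ^ (-(1 / 2) : ℝ)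
  have hd : ∀ t ∈ Set.Ioi (0 : ℝ), HasDerivAt G
      (N * ((1 + 2 * t) ^ (-(N / 2) : ℝ) * (t / (1 + 2 * t)) * t ^ (-(3 / 2) : ℝ)) -
        1 / 2 * ((1 - (1 + 2 * t) ^ (-(N / 2) : ℝ)) * t ^ (-(3 / 2) : ℝ))) t := by
    intro t (ht : 0 < t)
    have e1 : HasDerivAt (fun t : ℝ => (1 + 2 * t) ^ (-(N / 2) : ℝ))
        (2 * (-(N / 2) : ℝ) * (1 + 2 * t) ^ (-(N / 2) - 1 : ℝ)) t :=
      HasDerivAt.rpow_const (by simpa using ((hasDerivAt_id t).const_mul 2).const_add 1)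
        (Or.inl (by positivity))
    have e2 : HasDerivAt (fun t : ℝ => t ^ (-(1 / 2) : ℝ))
        ((-(1 / 2) : ℝ) * t ^ (-(1 / 2) - 1 : ℝ)) t := Real.hasDerivAt_rpow_const (Or.inl ht.ne')
    refine ((e1.const_sub 1).mul e2).congr_deriv ?_
    rw [Real.rpow_sub_one (by positivity), show (-(1 / 2) - 1 : ℝ) = -(3 / 2) by norm_num,
      show (-(1 / 2) : ℝ) = -(3 / 2) + 1 by norm_num, Real.rpow_add_one ht.ne']
    field_simp
    ring
  have hG0 : Filter.Tendsto G (nhdsWithin 0 (Set.Ioi 0)) (nhds 0) := by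
    have hup : Filter.Tendsto (fun t : ℝ => (N : ℝ) * t ^ (1 / 2 : ℝ))
        (nhdsWithin 0 (Set.Ioi 0)) (nhds 0) := by
      have : Filter.Tendsto (fun t : ℝ => (N : ℝ) * t ^ (1 / 2 : ℝ)) (nhds 0)
          (nhds ((N : ℝ) * 0 ^ (1 / 2 : ℝ))) :=
        ((Real.continuous_rpow_const (by norm_num)).tendsto 0).const_mul _
      rw [Real.zero_rpow (by norm_num), mul_zero] at this
      exact this.mono_left nhdsWithin_le_nhds
    refine squeeze_zero' ?_ ?_ hup
    · refine eventually_mem_nhdsWithin.mono fun t (ht : 0 < t) => mul_nonneg ?_ (by positivity)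
      exact sub_nonneg.2 (Real.rpow_le_one_of_one_le_of_nonpos (by linarith)
        (neg_nonpos.2 (by positivity)))
    · refine eventually_mem_nhdsWithin.mono fun t (ht : 0 < t) => ?_
      have hb : 1 - (1 + 2 * t) ^ (-(N / 2) : ℝ) ≤ N * t := by
        have hl : Real.log (1 + 2 * t) ≤ 2 * t := by
          linarith [Real.log_le_sub_one_of_pos (show 0 < 1 + 2 * t by positivity)]
        rw [Real.rpow_def_of_pos (by positivity)]
        have h5 := Real.add_one_le_exp (Real.log (1 + 2 * t) * -(N / 2))
        have h6 := mul_le_mul_of_nonneg_right hl (show (0 : ℝ) ≤ N / 2 by positivity)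
        linarith
      calc G t ≤ (N * t) * t ^ (-(1 / 2) : ℝ) := mul_le_mul_of_nonneg_right hb (by positivity)
        _ = N * t ^ (1 / 2 : ℝ) := by
          rw [mul_assoc, ← Real.rpow_one_add' ht.le (by norm_num)]
          norm_num
  have hGtop : Filter.Tendsto G Filter.atTop (nhds 0) := by
    refine squeeze_zero' ?_ ?_ (tendsto_rpow_neg_atTop (show (0 : ℝ) < 1 / 2 by norm_num))
    · refine (Filter.eventually_gt_atTop 0).mono fun t ht => mul_nonneg ?_ (by positivity)
      exact sub_nonneg.2 (Real.rpow_le_one_of_one_le_of_nonpos (by linarith)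
        (neg_nonpos.2 (by positivity)))
    · refine (Filter.eventually_gt_atTop 0).mono fun t ht => ?_
      refine mul_le_of_le_one_left (by positivity) (sub_le_self _ (by positivity))
  have hGzero : G 0 = 0 := by simp [G]
  have hFTC := integral_Ioi_of_hasDerivAt_of_tendsto (continuousWithinAt_Ioi_iff_Ici.1 (by
      simpa [ContinuousWithinAt, hGzero] using hG0)) hd
    ((hi1.const_mul _).sub (hi2.const_mul _)) hGtop
  rw [integral_sub (hi1.const_mul _) (hi2.const_mul _), integral_const_mul,
    integral_const_mul, hGzero] at hFTC
  linarith

/-! ### The curvature of the smoothed norm -/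

section Convexity

variable {E : Type*} [NormedAddCommGroup E] [InnerProductSpace ℝ E]

/-- The function is `s ↦ exp (-b * s) + b * s`, convex and increasing on `[0, ∞)`, composed with the
convex function `‖x‖ ^ 2`. -/
lemma convexOn_exp_neg_mul_norm_sq_add {b : ℝ} (hb : 0 ≤ b) :
    ConvexOn ℝ Set.univ (fun x : E => Real.exp (-b * ‖x‖ ^ 2) + b * ‖x‖ ^ 2) := by
  have hsq : ConvexOn ℝ Set.univ (fun x : E => ‖x‖ ^ 2) :=
    convexOn_univ_norm.pow (fun x _ => norm_nonneg x) 2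
  have hφ : ConvexOn ℝ Set.univ (fun s : ℝ => Real.exp (-b * s) + b * s) :=
    (convexOn_exp.comp_linearMap (LinearMap.mul ℝ ℝ (-b))).add
      ((LinearMap.mul ℝ ℝ b).convexOn convex_univ)
  have hmono : MonotoneOn (fun s : ℝ => Real.exp (-b * s) + b * s) (Set.Ici 0) := by
    intro s (hs : 0 ≤ s) s' _ hss
    have h1 : Real.exp (-b * s') = Real.exp (-b * s) * Real.exp (-(b * (s' - s))) := by
      rw [← Real.exp_add]; ring_nf
    have h2 := one_sub_exp_neg_mem (mul_nonneg hb (sub_nonneg.2 hss))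
    have h3 : Real.exp (-b * s) ≤ 1 := by
      rw [Real.exp_le_one_iff, neg_mul]
      exact neg_nonpos.2 (mul_nonneg hb hs)
    have h4 := mul_le_of_le_one_left h2.1 h3
    have h5 := h2.2.trans (min_le_left _ _)
    simp only [h1]
    linarith
  refine ⟨convex_univ, fun x _ y _ a c ha hc hac => ?_⟩
  refine (hmono (sq_nonneg ‖a • x + c • y‖) ?_
    (hsq.2 (Set.mem_univ x) (Set.mem_univ y) ha hc hac)).trans
    (hφ.2 (Set.mem_univ _) (Set.mem_univ _) ha hc hac)
  simp only [smul_eq_mul, Set.mem_Ici]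
  positivity

/-- If `L ‖y‖² - f y` is convex, then `f` lies below its quadratic expansion at any point where it
is differentiable: compare the convex function with its tangent along a line. -/
lemma le_add_inner_gradient_of_convexOn [CompleteSpace E] {f : E → ℝ} {L : ℝ} {x : E}
    (hf : DifferentiableAt ℝ f x)
    (hc : ConvexOn ℝ Set.univ fun y => L * ‖y‖ ^ 2 - f y) (h : E) :
    f (x + h) ≤ f x + inner ℝ (gradient f x) h + L * ‖h‖ ^ 2 := by
  have hline : HasDerivAt (fun τ : ℝ => x + τ • h) h 0 := by
    simpa using ((hasDerivAt_id (0 : ℝ)).smul_const h).const_add x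
  have hd : HasDerivAt (fun τ : ℝ => L * ‖x + τ • h‖ ^ 2 - f (x + τ • h))
      (L * (2 * inner ℝ x h) - inner ℝ (gradient f x) h) 0 := by
    have h1 : HasDerivAt (fun τ : ℝ => ‖x + τ • h‖ ^ 2) (2 * inner ℝ x h) 0 := by
      simpa using hline.norm_sq
    have h2 : HasDerivAt (fun τ : ℝ => f (x + τ • h)) (inner ℝ (gradient f x) h) 0 := by
      have hg : HasFDerivAt f (fderiv ℝ f x) (x + (0 : ℝ) • h) := by simpa using hf.hasFDerivAt
      have := hg.comp_hasDerivAt (0 : ℝ) hline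
      simpa [gradient, Function.comp_def] using this
    exact (h1.const_mul L).sub h2
  have hconv : ConvexOn ℝ Set.univ (fun τ : ℝ => L * ‖x + τ • h‖ ^ 2 - f (x + τ • h)) := by
    have := hc.comp_affineMap (AffineMap.lineMap x (x + h))
    simpa [Function.comp_def, AffineMap.lineMap_apply, add_comm] using this
  have hs := hconv.le_slope_of_hasDerivAt (Set.mem_univ 0) (Set.mem_univ 1) zero_lt_one hd
  simp only [slope_def_field, one_smul, zero_smul, add_zero, sub_zero, div_one] at hs
  rw [norm_add_sq_real] at hs
  linarith

end Convexity

/-- The curvature of the smoothed norm is at most `1 / √N`. In the mixture representation each term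
has its largest curvature at the origin, where the total is `𝔼 ‖u‖ / N ≤ √N / N`. -/
lemma convexOn_norm_sq_sub_gaussPotential_one (hN : 1 ≤ N) :
    ConvexOn ℝ Set.univ fun x => 1 / (2 * √N) * ‖x‖ ^ 2 - gaussPotential N 1 x := by
  obtain ⟨hKi, hK⟩ := integral_curvature N
  set K := ∫ t in Set.Ioi (0 : ℝ), (1 + 2 * t) ^ (-(N / 2) : ℝ) * (t / (1 + 2 * t)) *
      t ^ (-(3 / 2) : ℝ)
  have hJ := levyConst_pos
  have hN0 : (0 : ℝ) < N := by exact_mod_cast hN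
  have hsq : ConvexOn ℝ Set.univ (fun x : EuclideanSpace ℝ (Fin N) => ‖x‖ ^ 2) :=
    convexOn_univ_norm.pow (fun x _ => norm_nonneg x) 2
  have hKle : 0 ≤ 1 / (2 * √N) - K / levyConst := by
    have h0 : gaussPotential N 1 0 ≤ √N := by
      simpa [gaussPotential_apply] using integral_norm_stdGaussian_le N
    have h1 : N * K ≤ levyConst * √N / 2 := by
      rw [hK]
      gcongr
    have hs : √(N : ℝ) * √N = N := Real.mul_self_sqrt hN0.le
    have hs0 : 0 < √(N : ℝ) := Real.sqrt_pos.2 hN0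
    rw [sub_nonneg, div_le_div_iff₀ hJ (by positivity)]
    nth_rewrite 1 [← hs] at h1
    have h2 : √(N : ℝ) * (K * (2 * √N)) ≤ √(N : ℝ) * (1 * levyConst) := by linarith
    exact le_of_mul_le_mul_left h2 hs0
  have hQ : ConvexOn ℝ Set.univ fun x : EuclideanSpace ℝ (Fin N) =>
      K * ‖x‖ ^ 2 - levyConst * gaussPotential N 1 x := by
    let k : EuclideanSpace ℝ (Fin N) → ℝ → ℝ := fun x t =>
      (1 + 2 * t) ^ (-(N / 2) : ℝ) * (t / (1 + 2 * t)) * t ^ (-(3 / 2) : ℝ) * ‖x‖ ^ 2 -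
      (1 - (1 + 2 * t) ^ (-(N / 2) : ℝ) * Real.exp (-(t / (1 + 2 * t)) * ‖x‖ ^ 2)) *
        t ^ (-(3 / 2) : ℝ)
    have hk (x) : IntegrableOn (k x) (Set.Ioi 0) :=
      (hKi.mul_const _).sub (levy_gaussPotential x).1
    have hI (x) : K * ‖x‖ ^ 2 - levyConst * gaussPotential N 1 x =
        ∫ t in Set.Ioi (0 : ℝ), k x t := by
      simp only [k]
      rw [integral_sub (hKi.mul_const _) (levy_gaussPotential x).1, integral_mul_const,
        (levy_gaussPotential x).2]
    refine ⟨convex_univ, fun x _ y _ a b ha hb hab => ?_⟩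
    simp only [hI, smul_eq_mul]
    rw [← integral_const_mul, ← integral_const_mul,
      ← integral_add ((hk x).const_mul a) ((hk y).const_mul b)]
    refine setIntegral_mono_on (hk _) (((hk x).const_mul a).add ((hk y).const_mul b))
      measurableSet_Ioi fun t (ht : 0 < t) => ?_
    have hc := (convexOn_exp_neg_mul_norm_sq_add (E := EuclideanSpace ℝ (Fin N))
      (show 0 ≤ t / (1 + 2 * t) by positivity)).2 (Set.mem_univ x) (Set.mem_univ y) ha hb hab
    have hw : 0 ≤ (1 + 2 * t) ^ (-(N / 2) : ℝ) * t ^ (-(3 / 2) : ℝ) := by positivity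
    have := mul_le_mul_of_nonneg_left hc hw
    simp only [k, smul_eq_mul] at this ⊢
    have hb' : b = 1 - a := by linarith
    subst hb'
    linarith
  refine ((hsq.smul hKle).add (hQ.smul (inv_nonneg.2 hJ.le))).congr fun x _ => ?_
  simp only [Pi.add_apply, smul_eq_mul]
  field_simp
  ring

lemma gaussPotential_eq_mul {η : ℝ} (hη : 0 < η) (x : EuclideanSpace ℝ (Fin N)) :
    gaussPotential N η x = η * gaussPotential N 1 (η⁻¹ • x) := by
  rw [gaussPotential_apply, gaussPotential_apply, ← integral_const_mul]
  congr 1 with u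
  rw [← Real.norm_of_nonneg hη.le, ← norm_smul, Real.norm_of_nonneg hη.le, smul_add,
    smul_inv_smul₀ hη.ne', one_smul]

lemma convexOn_norm_sq_sub_gaussPotential (hN : 1 ≤ N) {η : ℝ} (hη : 0 < η) :
    ConvexOn ℝ Set.univ fun x => 1 / (2 * √N * η) * ‖x‖ ^ 2 - gaussPotential N η x := by
  have h := ((convexOn_norm_sq_sub_gaussPotential_one hN).comp_linearMap
    (η⁻¹ • LinearMap.id)).smul hη.le
  refine h.congr fun x _ => ?_
  simp only [gaussPotential_eq_mul hη x, Function.comp_apply, LinearMap.smul_apply,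
    LinearMap.id_apply, norm_smul, norm_inv, Real.norm_of_nonneg hη.le, smul_eq_mul]
  field_simp

lemma gaussPotential_add_le (hN : 1 ≤ N) {η : ℝ} (hη : 0 < η) (x h : EuclideanSpace ℝ (Fin N)) :
    gaussPotential N η (x + h) ≤ gaussPotential N η x + inner ℝ (gradient (gaussPotential N η) x) h
      + 1 / (2 * √N * η) * ‖h‖ ^ 2 :=
  le_add_inner_gradient_of_convexOn (differentiable_gaussPotential hN hη x)
    (convexOn_norm_sq_sub_gaussPotential hN hη) h

lemma gaussPotential_le_add {η η' : ℝ} (h : η ≤ η') (x : EuclideanSpace ℝ (Fin N)) :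
    gaussPotential N η' x ≤ gaussPotential N η x + (η' - η) * √N := by
  have hη : 0 ≤ η' - η := sub_nonneg.2 h
  have hu : Integrable (fun u => ‖u‖) (stdGaussian (EuclideanSpace ℝ (Fin N))) :=
    integrable_id_stdGaussian.norm
  refine le_trans ?_ (add_le_add_right
    (mul_le_mul_of_nonneg_left (integral_norm_stdGaussian_le N) hη) _)
  rw [gaussPotential_apply, gaussPotential_apply, ← integral_const_mul,
    ← integral_add (integrable_norm_add_smul η x) (hu.const_mul _)]
  refine integral_mono (integrable_norm_add_smul η' x)
    ((integrable_norm_add_smul η x).add (hu.const_mul _)) fun u => ?_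
  have : x + η' • u = (x + η • u) + (η' - η) • u := by module
  simp only [this]
  refine (norm_add_le _ _).trans_eq ?_
  rw [norm_smul, Real.norm_of_nonneg hη]

/-! ### Regret bounds -/

lemma cumReward_zero {E : Type*} [NormedAddCommGroup E] [InnerProductSpace ℝ E] (θ : ℕ → E) :
    cumReward θ 0 = 0 := by simp [cumReward]

lemma cumReward_succ {E : Type*} [NormedAddCommGroup E] [InnerProductSpace ℝ E] (θ : ℕ → E)
    (k : ℕ) : cumReward θ (k + 1) = cumReward θ k + θ (k + 1) := by
  rw [cumReward, cumReward, Finset.sum_Icc_succ_top (by omega)]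

/-- Per round, the potential grows by at most the learner's gain plus the curvature term, and
raising the scale from `η t` to `η (t + 1)` costs at most `(η (t + 1) - η t) * √N`. Both costs
telescope. -/
lemma regret_gaussGBPA_le (hN : 1 ≤ N) {T : ℕ} (hT : 1 ≤ T)
    (θ : ℕ → EuclideanSpace ℝ (Fin N)) (η : ℕ → ℝ) (hη : ∀ t ∈ Finset.Icc 1 T, 0 < η t)
    (hmono : MonotoneOn η (Set.Icc 1 T)) :
    regret (ball N) T (gaussGBPA N η θ) θ ≤
      η T * √N + 1 / (2 * √N) * ∑ t ∈ Finset.Icc 1 T, 1 / η t * ‖θ t‖ ^ 2 := by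
  let w := gaussGBPA N η θ
  have hstep (k : ℕ) (hk : k + 1 ≤ T) : gaussPotential N (η (k + 1)) (cumReward θ (k + 1)) ≤
      gaussPotential N (η (k + 1)) (cumReward θ k) + inner ℝ (w (k + 1)) (θ (k + 1)) +
      1 / (2 * √N) * (1 / η (k + 1) * ‖θ (k + 1)‖ ^ 2) := by
    rw [cumReward_succ]
    refine (gaussPotential_add_le hN (hη (k + 1) (by simp [hk])) _ _).trans_eq ?_
    simp only [w, gaussGBPA, gbpaPlay, Nat.add_sub_cancel]
    field_simp
  have hind : ∀ k, 1 ≤ k → k ≤ T → gaussPotential N (η k) (cumReward θ k) -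
      ∑ t ∈ Finset.Icc 1 k, inner ℝ (w t) (θ t) ≤
      η k * √N + 1 / (2 * √N) * ∑ t ∈ Finset.Icc 1 k, 1 / η t * ‖θ t‖ ^ 2 := by
    intro k hk
    induction k, hk using Nat.le_induction with
    | base =>
      intro _
      have h1 := hstep 0 hT
      have h2 := gaussPotential_le_add (N := N) (hη 1 (by simp [hT])).le 0
      -- The initial potential is compared with scale `0`, that is, with the norm itself.
      have h3 : gaussPotential N 0 0 = 0 := by simp [gaussPotential_apply]
      rw [zero_add, cumReward_zero] at h1
      simp only [Finset.Icc_self, Finset.sum_singleton]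
      linarith
    | succ k hk ih =>
      intro hkT
      have h0 := ih (by omega)
      have h1 := hstep k hkT
      have h2 := gaussPotential_le_add (N := N)
        (hmono ⟨hk, by omega⟩ ⟨by omega, hkT⟩ (Nat.le_succ k)) (cumReward θ k)
      rw [Finset.sum_Icc_succ_top (by omega), Finset.sum_Icc_succ_top (by omega), mul_add]
      linarith
  have h := hind T hT le_rfl
  have h' := norm_le_gaussPotential (η T) (cumReward θ T)
  rw [regret, baselinePotential_ball]
  linarith

lemma regret_hindsight_le (hN : 1 ≤ N) {T : ℕ} (hT : 1 ≤ T) (θ : ℕ → EuclideanSpace ℝ (Fin N)) :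
    regret (ball N) T (gaussGBPA N (hindsightScale N T θ) θ) θ ≤
      √(2 * ∑ t ∈ Finset.Icc 1 T, ‖θ t‖ ^ 2) := by
  set S := ∑ t ∈ Finset.Icc 1 T, ‖θ t‖ ^ 2 with hS
  have hN0 : (0 : ℝ) < N := by exact_mod_cast hN
  have hS0 : 0 ≤ S := Finset.sum_nonneg fun t _ => sq_nonneg _
  rcases hS0.eq_or_lt with h0 | hpos
  · have hθ : ∀ t ∈ Finset.Icc 1 T, θ t = 0 := by
      intro t ht
      have := (Finset.sum_eq_zero_iff_of_nonneg fun t _ => sq_nonneg ‖θ t‖).1 h0.symm t ht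
      simpa using this
    have h1 : cumReward θ T = 0 := Finset.sum_eq_zero hθ
    rw [regret, baselinePotential_ball, h1,
      Finset.sum_eq_zero fun t ht => by rw [hθ t ht, inner_zero_right]]
    simp
  · set η := √(S / (2 * N)) with hηd
    have hη : 0 < η := Real.sqrt_pos.2 (by positivity)
    have hconst : hindsightScale N T θ = fun _ => η := rfl
    have h := regret_gaussGBPA_le hN hT θ (hindsightScale N T θ) (fun _ _ => hη)
      (fun _ _ _ _ _ => le_rfl)
    refine h.trans_eq ?_
    simp only [hconst]
    rw [← Finset.mul_sum, ← hS]
    have hs : √(N : ℝ) ^ 2 = N := Real.sq_sqrt hN0.le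
    have hs0 : 0 < √(N : ℝ) := Real.sqrt_pos.2 hN0
    have hη2 : η ^ 2 * (2 * √(N : ℝ) ^ 2) = S := by
      rw [hs, hηd, Real.sq_sqrt (by positivity)]
      field_simp
    have h2 : √(2 * S) = 2 * (η * √N) := by
      rw [Real.sqrt_eq_iff_mul_self_eq (by positivity) (by positivity), ← hη2]
      ring
    rw [h2, ← hη2]
    field_simp
    ring

lemma adaptiveScale_pos (hN : 1 ≤ N) (θ : ℕ → EuclideanSpace ℝ (Fin N)) (t : ℕ) :
    0 < adaptiveScale N θ t := by
  have hN0 : (0 : ℝ) < N := by exact_mod_cast hN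
  have hS0 : 0 ≤ ∑ s ∈ Finset.Icc 1 (t - 1), ‖θ s‖ ^ 2 := Finset.sum_nonneg fun t _ => sq_nonneg _
  exact Real.sqrt_pos.2 (by positivity)

lemma adaptiveScale_mono (θ : ℕ → EuclideanSpace ℝ (Fin N)) : Monotone (adaptiveScale N θ) := by
  intro s t hst
  unfold adaptiveScale
  gcongr

/-- The term `1 / (2 √x)` in the potential absorbs the excess of `a / (2 √x)` over
`√(x + a) - √x`; this needs `a ≤ 1`. -/
lemma div_two_sqrt_le {x a : ℝ} (hx : 0 < x) (ha : 0 ≤ a) (ha1 : a ≤ 1) :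
    a / (2 * √x) ≤ (√(x + a) - 1 / (2 * √(x + a))) - (√x - 1 / (2 * √x)) := by
  set p := √x
  set q := √(x + a)
  have hp : 0 < p := Real.sqrt_pos.2 hx
  have hpq : p ≤ q := Real.sqrt_le_sqrt (by linarith)
  have hq : 0 < q := hp.trans_le hpq
  have hp2 : p ^ 2 = x := Real.sq_sqrt hx.le
  have hq2 : q ^ 2 = x + a := Real.sq_sqrt (by linarith)
  have haq : a = (q - p) * (q + p) := by linarith
  have key : 0 ≤ (q - p) * (q + p - a * q) := by
    refine mul_nonneg (by linarith) ?_
    linarith [mul_le_of_le_one_left hq.le ha1]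
  have : (q - 1 / (2 * q)) - (p - 1 / (2 * p)) - a / (2 * p) =
      (q - p) * (2 * p * q + 1 - q * (q + p)) / (2 * p * q) := by
    rw [haq]
    field_simp
    ring
  have h3 : 0 ≤ (q - p) * (2 * p * q + 1 - q * (q + p)) := by
    refine mul_nonneg (by linarith) ?_
    have : a * q ≤ q + p := by linarith [mul_le_of_le_one_left hq.le ha1]
    rw [haq] at this
    have : (q - p) * q ≤ 1 := le_of_mul_le_mul_right (by linarith) (add_pos hq hp)
    linarith
  have h4 := div_nonneg h3 (show 0 ≤ 2 * p * q by positivity)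
  linarith

lemma regret_adaptive_le (hN : 1 ≤ N) {T : ℕ} (hT : 1 ≤ T) (θ : ℕ → EuclideanSpace ℝ (Fin N))
    (hθ : IsRewardSeq (ball N) T θ) :
    regret (ball N) T (gaussGBPA N (adaptiveScale N θ) θ) θ ≤
      2 * √(1 + ∑ t ∈ Finset.Icc 1 T, ‖θ t‖ ^ 2) := by
  have hN0 : (0 : ℝ) < N := by exact_mod_cast hN
  have hs0 : 0 < √(N : ℝ) := Real.sqrt_pos.2 hN0
  let X : ℕ → ℝ := fun k => 1 + ∑ t ∈ Finset.Icc 1 k, ‖θ t‖ ^ 2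
  have hX0 (k) : 0 < X k := by
    have : 0 ≤ ∑ s ∈ Finset.Icc 1 k, ‖θ s‖ ^ 2 := Finset.sum_nonneg fun t _ => sq_nonneg _
    simp only [X]; positivity
  have hXs (k) : X (k + 1) = X k + ‖θ (k + 1)‖ ^ 2 := by
    simp only [X]
    rw [Finset.sum_Icc_succ_top (by omega), add_assoc]
  have hη (t) : adaptiveScale N θ t = √(X (t - 1)) / √N := Real.sqrt_div (hX0 _).le _
  have hsum : ∀ k ≤ T, ∑ t ∈ Finset.Icc 1 k, ‖θ t‖ ^ 2 / (2 * √(X (t - 1))) ≤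
      (√(X k) - 1 / (2 * √(X k))) - 1 / 2 := by
    intro k
    induction k with
    | zero => intro _; norm_num [X]
    | succ k ih =>
      intro hk
      have hle : ‖θ (k + 1)‖ ≤ 1 := by simpa [ball] using hθ (k + 1) (by simp [hk])
      have h1 := div_two_sqrt_le (hX0 k) (sq_nonneg ‖θ (k + 1)‖) (pow_le_one₀ (norm_nonneg _) hle)
      have h2 := ih (by omega)
      rw [Finset.sum_Icc_succ_top (by omega), Nat.add_sub_cancel, hXs]
      linarith
  have hreg := regret_gaussGBPA_le hN hT θ (adaptiveScale N θ)
    (fun t _ => adaptiveScale_pos hN θ t) ((adaptiveScale_mono θ).monotoneOn _)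
  have hconv : 1 / (2 * √(N : ℝ)) * ∑ t ∈ Finset.Icc 1 T, 1 / adaptiveScale N θ t * ‖θ t‖ ^ 2 =
      ∑ t ∈ Finset.Icc 1 T, ‖θ t‖ ^ 2 / (2 * √(X (t - 1))) := by
    rw [Finset.mul_sum]
    refine Finset.sum_congr rfl fun t _ => ?_
    have := Real.sqrt_pos.2 (hX0 (t - 1))
    rw [hη]
    field_simp
  have hlast : adaptiveScale N θ T * √N ≤ √(X T) := by
    rw [hη, div_mul_cancel₀ _ hs0.ne']
    refine Real.sqrt_le_sqrt ?_
    obtain ⟨k, rfl⟩ : ∃ k, T = k + 1 := ⟨T - 1, by omega⟩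
    rw [Nat.add_sub_cancel, hXs]
    linarith [sq_nonneg ‖θ (k + 1)‖]
  rw [hconv] at hreg
  have hS := hsum T le_rfl
  have : 0 ≤ 1 / (2 * √(X T)) := by positivity
  change _ ≤ 2 * √(X T)
  linarith

/-! ### The adaptive algorithm in the minimax game -/

lemma isLearner_adaptive (N T : ℕ) :
    IsLearner (ball N) (ball N) T (fun θ => gaussGBPA N (adaptiveScale N θ) θ) := by
  refine ⟨fun θ _ t _ => ?_, fun θ θ' _ _ t _ h => ?_⟩
  · rw [ball, mem_closedBall_zero_iff]
    exact norm_gradient_gaussPotential_le _ _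
  · have h1 : adaptiveScale N θ t = adaptiveScale N θ' t := by
      unfold adaptiveScale
      rw [Finset.sum_congr rfl fun s hs => by rw [h s hs]]
    have h2 : cumReward θ (t - 1) = cumReward θ' (t - 1) := Finset.sum_congr rfl h
    simp only [gaussGBPA, gbpaPlay, h1, h2]

lemma worstCaseRegret_adaptive_le (hN : 1 ≤ N) {T : ℕ} (hT : 1 ≤ T) :
    worstCaseRegret (ball N) (ball N) T (fun θ => gaussGBPA N (adaptiveScale N θ) θ) ≤
      ((2 * √(1 + (T : ℝ)) : ℝ) : EReal) := by
  refine iSup₂_le fun θ hθ => EReal.coe_le_coe_iff.2 ((regret_adaptive_le hN hT θ hθ).trans ?_)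
  have : ∑ t ∈ Finset.Icc 1 T, ‖θ t‖ ^ 2 ≤ ∑ t ∈ Finset.Icc 1 T, (1 : ℝ) :=
    Finset.sum_le_sum fun t ht => pow_le_one₀ (norm_nonneg _) (by simpa [ball] using hθ t ht)
  simp only [Finset.sum_const, Nat.card_Icc, Nat.add_sub_cancel, nsmul_eq_mul, mul_one] at this
  gcongr

/-! ### The minimax lower bound -/

/-- The potential of the adversary with `n` rounds to go and cumulative reward `r • e`. Up to a
term linear in `n`, it is the expectation of `α s² - β s⁴` at `s = r + ε₁ + ⋯ + ε_n` with
independent random signs `ε_i`. Dropping that term keeps what is needed: the average of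
the potentials at `r ± 1` with `n - 1` rounds to go is at least the potential at `r`. -/
def adversaryPotential (α β n r : ℝ) : ℝ :=
  α * (r ^ 2 + n) - β * (r ^ 4 + 6 * r ^ 2 * n + 3 * n ^ 2)

/-- Against any learner, rewards `± e` can be chosen round by round so that the potential minus
the learner's gain never decreases: the gains for `e` and `-e` cancel, so one of the two
signs does at least as well as the average. Changing the reward of round `k + 1` does not affect the
plays up to that round, which is where the learner's ignorance of the future enters. -/
lemma exists_adversary {T : ℕ} {A : (ℕ → EuclideanSpace ℝ (Fin N)) → ℕ → EuclideanSpace ℝ (Fin N)}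
    (hA : IsLearner (ball N) (ball N) T A) {e : EuclideanSpace ℝ (Fin N)} (he : ‖e‖ = 1)
    (α : ℝ) {β : ℝ} (hβ : 0 ≤ β) {k : ℕ} (hk : k ≤ T) :
    ∃ (θ : ℕ → EuclideanSpace ℝ (Fin N)) (r : ℝ), IsRewardSeq (ball N) T θ ∧
      cumReward θ k = r • e ∧
      adversaryPotential α β T 0 ≤ adversaryPotential α β (T - k) r -
        ∑ t ∈ Finset.Icc 1 k, inner ℝ (A θ t) (θ t) := by
  induction k with
  | zero => exact ⟨0, 0, fun t _ => by simp [ball], by simp [cumReward], by simp⟩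
  | succ k ih =>
    obtain ⟨θ, r, hθ, hr, hψ⟩ := ih (by omega)
    set g := inner ℝ (A θ (k + 1)) e
    have hstep (ε : ℝ) (hε : |ε| = 1)
        (h : adversaryPotential α β (T - k) r ≤
          adversaryPotential α β (T - (k + 1 : ℕ)) (r + ε) - ε * g) :
        ∃ (θ : ℕ → EuclideanSpace ℝ (Fin N)) (r : ℝ), IsRewardSeq (ball N) T θ ∧
          cumReward θ (k + 1) = r • e ∧
          adversaryPotential α β T 0 ≤ adversaryPotential α β (T - (k + 1 : ℕ)) r -
            ∑ t ∈ Finset.Icc 1 (k + 1), inner ℝ (A θ t) (θ t) := by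
      set θ' := Function.update θ (k + 1) (ε • e) with hθ'd
      have hlt : ∀ s ∈ Finset.Icc 1 k, θ' s = θ s := fun s hs =>
        Function.update_of_ne (by have := Finset.mem_Icc.1 hs; omega) _ _
      have hlast : θ' (k + 1) = ε • e := Function.update_self _ _ _
      have hθ' : IsRewardSeq (ball N) T θ' := by
        intro t ht
        rcases eq_or_ne t (k + 1) with rfl | hne
        · rw [hlast, ball, mem_closedBall_zero_iff, norm_smul, he, Real.norm_eq_abs, hε, one_mul]
        · rw [hθ'd, Function.update_of_ne hne]
          exact hθ t ht
      have hplay : ∀ t ∈ Finset.Icc 1 (k + 1), A θ' t = A θ t := fun t ht =>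
        have ht' := Finset.mem_Icc.1 ht
        hA.2 θ' θ hθ' hθ t (Finset.mem_Icc.2 ⟨ht'.1, ht'.2.trans hk⟩) fun s hs =>
          hlt s (Finset.mem_Icc.2 ⟨(Finset.mem_Icc.1 hs).1, by
            have := (Finset.mem_Icc.1 hs).2; omega⟩)
      refine ⟨θ', r + ε, hθ', ?_, ?_⟩
      · rw [cumReward_succ, hlast, add_smul, ← hr]
        congr 1
        exact Finset.sum_congr rfl hlt
      · rw [Finset.sum_Icc_succ_top (by omega), hplay (k + 1) (by simp), hlast,
          real_inner_smul_right,
          Finset.sum_congr rfl fun t ht => by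
            rw [hplay t (Finset.Icc_subset_Icc_right (Nat.le_succ k) ht), hlt t ht]]
        linarith
    by_cases h : adversaryPotential α β (T - k) r ≤
        adversaryPotential α β (T - (k + 1 : ℕ)) (r + 1) - 1 * g
    · exact hstep 1 (by simp) h
    · refine hstep (-1) (by simp) ?_
      -- If both signs failed, adding the two inequalities would contradict the averaging
      -- property of the potential.
      push_cast [adversaryPotential] at h ⊢
      nlinarith

lemma le_minimaxRegret (hN : 1 ≤ N) {T : ℕ} (hT : 1 ≤ T) :
    ((√(T / 3) : ℝ) : EReal) ≤ minimaxRegret (ball N) (ball N) T := by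
  refine le_iInf₂ fun A hA => ?_
  let e : EuclideanSpace ℝ (Fin N) := EuclideanSpace.single ⟨0, hN⟩ 1
  have he : ‖e‖ = 1 := by simp [e]
  have hT0 : (0 : ℝ) < T := by exact_mod_cast hT
  let m : ℝ := √(T / 3)
  have hm : 0 < m := Real.sqrt_pos.2 (by positivity)
  have hm2 : (T : ℝ) = 3 * m ^ 2 := by
    rw [Real.sq_sqrt (by positivity)]; ring
  -- `q = √(3T)`: for this scale `|r|` exceeds the quartic final potential, with a double
  -- contact at `|r| = q`, and the initial potential is `T / q = m`.
  let q : ℝ := 3 * m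
  have hq : 0 < q := by positivity
  obtain ⟨θ, r, hθ, hr, hψ⟩ := exists_adversary hA he (3 / (2 * q))
    (show 0 ≤ 1 / (2 * q ^ 3) by positivity) le_rfl
  refine le_trans (EReal.coe_le_coe_iff.2 ?_)
    (le_iSup₂ (f := fun θ _ => ((regret (ball N) T (A θ) θ : ℝ) : EReal)) θ hθ)
  rw [regret, baselinePotential_ball, hr]
  change m ≤ ‖r • e‖ - _
  rw [norm_smul, he, mul_one, Real.norm_eq_abs]
  have h0 : adversaryPotential (3 / (2 * q)) (1 / (2 * q ^ 3)) T 0 = m := by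
    rw [adversaryPotential, hm2]
    simp only [q]
    field_simp
    ring
  have h1 : adversaryPotential (3 / (2 * q)) (1 / (2 * q ^ 3)) (T - T) r ≤ |r| := by
    have : |r| - adversaryPotential (3 / (2 * q)) (1 / (2 * q ^ 3)) (T - T) r =
        |r| * ((|r| - q) ^ 2 * (|r| + 2 * q)) / (2 * q ^ 3) := by
      rw [adversaryPotential, ← sq_abs r,
        show r ^ 4 = |r| ^ 4 from (Even.pow_abs (by decide) r).symm]
      field_simp
      ring
    have h2 : 0 ≤ |r| * ((|r| - q) ^ 2 * (|r| + 2 * q)) / (2 * q ^ 3) := by positivity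
    linarith
  linarith

end OLO

theorem theorem4p5 :
    -- the baseline potential is a maximum and equals the Euclidean norm
    (∀ N : ℕ, 1 ≤ N → ∀ Θ : EuclideanSpace ℝ (Fin N),
      IsGreatest ((fun w => inner ℝ w Θ) '' OLO.ball N) (OLO.baselinePotential (OLO.ball N) Θ) ∧
      OLO.baselinePotential (OLO.ball N) Θ = ‖Θ‖) ∧
    -- the smoothed potentials are well defined and admissible for the algorithm
    (∀ N : ℕ, 1 ≤ N → ∀ η : ℝ, 0 < η →
      (∀ Θ : EuclideanSpace ℝ (Fin N), MeasureTheory.Integrable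
        (fun u => OLO.baselinePotential (OLO.ball N) (Θ + η • u))
        (ProbabilityTheory.stdGaussian (EuclideanSpace ℝ (Fin N)))) ∧
      Differentiable ℝ (OLO.gaussPotential N η) ∧
      ∀ Θ : EuclideanSpace ℝ (Fin N), gradient (OLO.gaussPotential N η) Θ ∈ OLO.ball N) ∧
    -- the three regret bounds
    (∀ N T : ℕ, 1 ≤ N → 1 ≤ T → ∀ θ : ℕ → EuclideanSpace ℝ (Fin N),
      OLO.IsRewardSeq (OLO.ball N) T θ →
      (∀ η : ℕ → ℝ, (∀ t ∈ Finset.Icc 1 T, 0 < η t) → MonotoneOn η (Set.Icc 1 T) →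
        OLO.regret (OLO.ball N) T (OLO.gaussGBPA N η θ) θ ≤
          η T * Real.sqrt N +
            1 / (2 * Real.sqrt N) * ∑ t ∈ Finset.Icc 1 T, 1 / η t * ‖θ t‖ ^ 2) ∧
      OLO.regret (OLO.ball N) T (OLO.gaussGBPA N (OLO.hindsightScale N T θ) θ) θ ≤
        Real.sqrt (2 * ∑ t ∈ Finset.Icc 1 T, ‖θ t‖ ^ 2) ∧
      OLO.regret (OLO.ball N) T (OLO.gaussGBPA N (OLO.adaptiveScale N θ) θ) θ ≤
        2 * Real.sqrt (1 + ∑ t ∈ Finset.Icc 1 T, ‖θ t‖ ^ 2)) ∧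
    -- minimax optimality of the adaptive algorithm up to a universal constant
    (∃ C : ℝ, 0 < C ∧ ∀ N T : ℕ, 1 ≤ N → 1 ≤ T →
      OLO.IsLearner (OLO.ball N) (OLO.ball N) T
        (fun θ => OLO.gaussGBPA N (OLO.adaptiveScale N θ) θ) ∧
      OLO.worstCaseRegret (OLO.ball N) (OLO.ball N) T
          (fun θ => OLO.gaussGBPA N (OLO.adaptiveScale N θ) θ) ≤
        ((2 * Real.sqrt (1 + (T : ℝ)) : ℝ) : EReal) ∧
      ((2 * Real.sqrt (1 + (T : ℝ)) : ℝ) : EReal) ≤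
        (C : EReal) * OLO.minimaxRegret (OLO.ball N) (OLO.ball N) T) := by
  refine ⟨fun N _ Θ => ?_, fun N hN η hη => ⟨fun Θ => ?_, OLO.differentiable_gaussPotential hN hη,
    fun Θ => ?_⟩, fun N T hN hT θ hθ => ⟨OLO.regret_gaussGBPA_le hN hT θ,
      OLO.regret_hindsight_le hN hT θ, OLO.regret_adaptive_le hN hT θ hθ⟩,
    5, by norm_num, fun N T hN hT => ⟨OLO.isLearner_adaptive N T,
      OLO.worstCaseRegret_adaptive_le hN hT, ?_⟩⟩
  · rw [OLO.baselinePotential_ball]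
    exact ⟨OLO.baselinePotential_ball_isGreatest Θ, rfl⟩
  · rw [OLO.baselinePotential_ball]
    exact OLO.integrable_norm_add_smul η Θ
  · rw [OLO.ball, mem_closedBall_zero_iff]
    exact OLO.norm_gradient_gaussPotential_le η Θ
  · refine le_trans ?_ (mul_le_mul_of_nonneg_left (OLO.le_minimaxRegret hN hT)
      (EReal.coe_nonneg.2 (by norm_num)))
    rw [← EReal.coe_mul, EReal.coe_le_coe_iff]
    -- `4 (1 + T) ≤ 8 T ≤ 25 T / 3`
    have hT1 : (1 : ℝ) ≤ T := by exact_mod_cast hT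
    have e1 : 2 * √(1 + (T : ℝ)) = √(4 * (1 + T)) := by
      rw [Real.sqrt_mul (by norm_num), show √(4 : ℝ) = 2 from by
        rw [show (4 : ℝ) = 2 ^ 2 by norm_num]; exact Real.sqrt_sq (by norm_num)]
    have e2 : 5 * √((T : ℝ) / 3) = √(25 * (T / 3)) := by
      rw [Real.sqrt_mul (by norm_num), show √(25 : ℝ) = 5 from by
        rw [show (25 : ℝ) = 5 ^ 2 by norm_num]; exact Real.sqrt_sq (by norm_num)]
    rw [e1, e2]
    exact Real.sqrt_le_sqrt (by linarith)
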